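/- Let $(\mathcal X,d)$ be a complete separable metric space, let $\mathcal P(\mathcal X)$ be the set of all Borel probability measures on $\mathcal X$, and let $\lambda>0$. Put $c_\lambda(x,y)=\min\{d(x,y),2\lambda\}$ and, for $\mu,\nu\in\mathcal P(\mathcal X)$, $$W^{(\lambda)}(\mu,\nu)=\inf_{\pi\in\Pi(\mu,\nu)}\int_{\mathcal X\times\mathcal X}c_\lambda(x,y)\,d\pi(x,y),$$ where $\Pi(\mu,\nu)$ is the set of probability measures on $\mathcal X\times\mathcal X$ with first marginal $\mu$ and second marginal $\nu$. Then $W^{(\lambda)}$ is a metric on $\mathcal P(\mathcal X)$, and the metric space $(\mathcal P(\mathcal X),W^{(\lambda)})$ is complete and separable. Moreover, the set of finitely supported probability measures with rational coefficients, that is, the probability measures of the form $\sum_{j=1}^N b_j\delta_{x_j}$ with $x_j\in\mathcal X$ and $b_j\in\mathbb Q_{\ge 0}$, is dense in $(\mathcal P(\mathcal X),W^{(\lambda)})$. -/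

import Mathlib

open MeasureTheory TopologicalSpace
open scoped NNReal ENNReal

noncomputable section

/-- The trimmed cost `c_lam(x, y) = min {d(x, y), 2 lam}`. -/
def trimmedCost {X : Type*} [MetricSpace X] (lam : ℝ) (x y : X) : ℝ :=
  min (dist x y) (2 * lam)

/-- The set `Π(μ, ν)` of couplings: probability measures on `X × X` with first marginal `μ` and
second marginal `ν`. -/
def couplings {X : Type*} [MeasurableSpace X] (μ ν : ProbabilityMeasure X) :
    Set (ProbabilityMeasure (X × X)) :=
  {π | (π : Measure (X × X)).map Prod.fst = (μ : Measure X) ∧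
       (π : Measure (X × X)).map Prod.snd = (ν : Measure X)}

/-- The robust Wasserstein distance: the infimum over all couplings `π` of `μ` and `ν` of the
total trimmed cost `∫ c_lam dπ`. On a separable metric space with its Borel σ-algebra, the set of
couplings is non-empty (it contains the product measure) and, for `lam ≥ 0`, the cost is measurable
with values in `[0, 2 lam]`, so this is a genuine infimum of genuine integrals. -/
def robustWasserstein {X : Type*} [MetricSpace X] [MeasurableSpace X] (lam : ℝ)
    (μ ν : ProbabilityMeasure X) : ℝ :=
  sInf ((fun π : ProbabilityMeasure (X × X) =>
    ∫ z, trimmedCost lam z.1 z.2 ∂(π : Measure (X × X))) '' couplings μ ν)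

/-- The set of all Borel probability measures on `X`, as a type that carries no topology or
metric of its own (in Mathlib, `ProbabilityMeasure X` carries the topology of weak
convergence). -/
def ProbSpace (X : Type*) [MeasurableSpace X] : Type _ := ProbabilityMeasure X

/-- The finitely supported probability measures with rational coefficients:
`∑ x ∈ s, w x • δ_x` with `s` finite and `w x` rational. -/
def finiteRationalMeasures (X : Type*) [MeasurableSpace X] : Set (ProbSpace X) :=
  {μ : ProbabilityMeasure X | ∃ (s : Finset X) (w : X → ℚ≥0),
    (μ : Measure X) = ∑ x ∈ s, ((w x : ℝ≥0) : ℝ≥0∞) • Measure.dirac x}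

end

/-! Near-optimal couplings suffice; no optimal coupling is needed. A chain of couplings with
matching marginals is realized by one process (`exists_measure_map_consecutive_eq`): disintegrate
each coupling and run the Markov chain with these kernels. Three consecutive coordinates give the
triangle inequality. If the consecutive distances are summable, the total cost along a path is
almost surely finite, so its terms eventually fall below the cap `2 * lam`, where the cost is the
distance; paths then converge, and bounded costs converge in mean to zero. This is completeness.

Separation comes from Markov's inequality, which bounds the Lévy–Prokhorov distance. For density and
separability, send each point to the nearest of the first few points of a dense sequence, then make
the weights rational: any displaced mass costs at most `2 * lam` per unit, so no moment assumption
is needed. -/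

open MeasureTheory TopologicalSpace ProbabilityTheory Filter Topology Finset
open scoped NNReal ENNReal

/-! ### Gluing couplings into a process -/

section Gluing

/-- Composing a measure with a kernel that factors through `g`, and pushing the first coordinate
forward along `g`, amounts to pushing the measure forward first. -/
theorem map_compProd_comap {α β γ : Type*} [MeasurableSpace α] [MeasurableSpace β]
    [MeasurableSpace γ] (μ : Measure α) [SFinite μ] (κ : Kernel β γ) [IsSFiniteKernel κ]
    {g : α → β} (hg : Measurable g) :
    (μ ⊗ₘ (κ.comap g hg)).map (Prod.map g id) = (μ.map g) ⊗ₘ κ := by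
  ext s hs
  have hm : Measurable (Prod.map g (id : γ → γ)) := hg.prodMap measurable_id
  rw [Measure.map_apply hm hs, Measure.compProd_apply (hm hs), Measure.compProd_apply hs,
    lintegral_map (Kernel.measurable_kernel_prodMk_left hs) hg]
  rfl

/-- A sequence of probability measures on `X × X` whose consecutive marginals agree is realized
as the sequence of laws of consecutive pairs of a process. -/
theorem exists_measure_map_consecutive_eq {X : Type*} [MeasurableSpace X] [StandardBorelSpace X]
    [Nonempty X] (π : ℕ → Measure (X × X)) [∀ n, IsProbabilityMeasure (π n)]
    (h : ∀ n, (π n).map Prod.snd = (π (n + 1)).map Prod.fst) :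
    ∃ P : Measure (ℕ → X), IsProbabilityMeasure P ∧
      ∀ n, P.map (fun ω => (ω n, ω (n + 1))) = π n := by
  let last (n : ℕ) : (Finset.Iic n → X) → X := fun x => x ⟨n, Finset.mem_Iic.2 le_rfl⟩
  have hlast (n : ℕ) : Measurable (last n) := measurable_pi_apply _
  -- Markov transition: the next point depends on the history only through its last coordinate.
  let κ (n : ℕ) : Kernel (Finset.Iic n → X) X := (π n).condKernel.comap (last n) (hlast n)
  have hfst : IsProbabilityMeasure ((π 0).map Prod.fst) :=
    Measure.isProbabilityMeasure_map measurable_fst.aemeasurable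
  let P : Measure (ℕ → X) := Kernel.trajMeasure (X := fun _ => X) ((π 0).map Prod.fst) κ
  have hP : IsProbabilityMeasure P := by dsimp only [P]; infer_instance
  have key (n : ℕ) (hn : P.map (fun ω => ω n) = (π n).map Prod.fst) :
      P.map (fun ω => (ω n, ω (n + 1))) = π n := by
    have h1 := Kernel.map_frestrictLe_trajMeasure_compProd_eq_map_trajMeasure
      (X := fun _ => X) (μ₀ := (π 0).map Prod.fst) (κ := κ) (a := n)
    have h2 := congrArg (fun m => m.map (Prod.map (last n) id)) h1
    beta_reduce at h2
    rw [map_compProd_comap, Measure.map_map (hlast n) (by fun_prop),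
      Measure.map_map ((hlast n).prodMap measurable_id) (by fun_prop)] at h2
    have h3 : P.map (last n ∘ Preorder.frestrictLe n) = (π n).fst := hn
    change (P.map (last n ∘ Preorder.frestrictLe n)) ⊗ₘ (π n).condKernel = _ at h2
    rw [h3, Measure.disintegrate] at h2
    exact h2.symm
  have h0 (n : ℕ) : P.map (fun ω => ω n) = (π n).map Prod.fst := by
    induction n with
    | zero =>
      dsimp only [P, Kernel.trajMeasure]
      have e : (fun ω : ℕ → X => ω 0) = last 0 ∘ Preorder.frestrictLe 0 := rfl
      rw [e, ← Measure.map_map (hlast 0) (by fun_prop), Measure.map_comp _ _ (by fun_prop),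
        Kernel.traj_map_frestrictLe, Kernel.partialTraj_self, Measure.id_comp,
        Measure.map_map (hlast 0) (by fun_prop)]
      exact Measure.map_id
    | succ n ih =>
      rw [← h n, ← key n ih, Measure.map_map measurable_snd (by fun_prop)]
      rfl
  exact ⟨P, hP, fun n => key n (h0 n)⟩

end Gluing

/-! ### The trimmed cost -/

section Cost

variable {X : Type*} [MetricSpace X] {lam : ℝ}

theorem trimmedCost_nonneg (hlam : 0 ≤ lam) (x y : X) : 0 ≤ trimmedCost lam x y :=
  le_min dist_nonneg (by linarith)

theorem trimmedCost_le (x y : X) : trimmedCost lam x y ≤ 2 * lam := min_le_right _ _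

theorem trimmedCost_self (hlam : 0 ≤ lam) (x : X) : trimmedCost lam x x = 0 := by
  simp [trimmedCost, hlam]

theorem trimmedCost_comm (x y : X) : trimmedCost lam x y = trimmedCost lam y x := by
  simp [trimmedCost, dist_comm]

theorem trimmedCost_triangle (hlam : 0 ≤ lam) (x y z : X) :
    trimmedCost lam x z ≤ trimmedCost lam x y + trimmedCost lam y z := by
  have h := dist_triangle x y z
  have h1 := dist_nonneg (x := x) (y := y)
  have h2 := dist_nonneg (x := y) (y := z)
  unfold trimmedCost
  rcases min_cases (dist x y) (2 * lam) with h3 | h3 <;>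
  rcases min_cases (dist y z) (2 * lam) with h4 | h4 <;>
  rcases min_cases (dist x z) (2 * lam) with h5 | h5 <;> linarith

theorem dist_eq_trimmedCost {x y : X} (h : trimmedCost lam x y < 2 * lam) :
    dist x y = trimmedCost lam x y := by
  unfold trimmedCost at *
  rcases min_lt_iff.1 h with h | h
  · exact (min_eq_left h.le).symm
  · exact absurd h (lt_irrefl _)

theorem continuous_trimmedCost : Continuous fun z : X × X => trimmedCost lam z.1 z.2 :=
  continuous_dist.min continuous_const

theorem tendsto_trimmedCost_zero {ι : Type*} {l : Filter ι} (hlam : 0 ≤ lam) {u : ι → X} {x : X}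
    (h : Tendsto u l (𝓝 x)) : Tendsto (fun n => trimmedCost lam (u n) x) l (𝓝 0) := by
  have := (continuous_trimmedCost (lam := lam)).tendsto (x, x)
  rw [trimmedCost_self hlam] at this
  exact this.comp (h.prodMk_nhds tendsto_const_nhds)

variable [MeasurableSpace X] [BorelSpace X] [SeparableSpace X]

theorem measurable_trimmedCost {Ω : Type*} [MeasurableSpace Ω] {f g : Ω → X}
    (hf : Measurable f) (hg : Measurable g) :
    Measurable fun ω => trimmedCost lam (f ω) (g ω) := by
  have : SecondCountableTopology X := UniformSpace.secondCountable_of_separable X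
  exact continuous_trimmedCost.measurable.comp (hf.prodMk hg)

theorem integrable_trimmedCost {Ω : Type*} [MeasurableSpace Ω] {P : Measure Ω}
    [IsFiniteMeasure P] (hlam : 0 ≤ lam) {f g : Ω → X} (hf : Measurable f) (hg : Measurable g) :
    Integrable (fun ω => trimmedCost lam (f ω) (g ω)) P := by
  refine Integrable.of_bound (measurable_trimmedCost hf hg).aestronglyMeasurable (2 * lam) ?_
  filter_upwards with ω
  rw [Real.norm_of_nonneg (trimmedCost_nonneg hlam _ _)]
  exact trimmedCost_le _ _

/-- The expected trimmed cost tends to zero along an almost surely convergent family. -/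
theorem tendsto_integral_trimmedCost_zero {Ω : Type*} [MeasurableSpace Ω] {P : Measure Ω}
    [IsFiniteMeasure P] (hlam : 0 ≤ lam) {f : ℕ → Ω → X} {g : Ω → X}
    (hf : ∀ n, Measurable (f n)) (hg : Measurable g)
    (h : ∀ᵐ ω ∂P, Tendsto (fun n => f n ω) atTop (𝓝 (g ω))) :
    Tendsto (fun n => ∫ ω, trimmedCost lam (f n ω) (g ω) ∂P) atTop (𝓝 0) := by
  have := tendsto_integral_of_dominated_convergence (μ := P)
    (F := fun n ω => trimmedCost lam (f n ω) (g ω)) (f := fun _ => 0) (fun _ => 2 * lam)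
    (fun n => (measurable_trimmedCost (hf n) hg).aestronglyMeasurable) (integrable_const _)
    (fun n => ae_of_all _ fun ω => by
      rw [Real.norm_of_nonneg (trimmedCost_nonneg hlam _ _)]
      exact trimmedCost_le _ _)
    (h.mono fun ω hω => tendsto_trimmedCost_zero hlam hω)
  simpa using this

end Cost

/-! ### Metric axioms and completeness -/

section Distance

variable {X : Type*} [MetricSpace X] [MeasurableSpace X] {lam : ℝ}

theorem robustWasserstein_nonneg (hlam : 0 ≤ lam) (μ ν : ProbabilityMeasure X) :
    0 ≤ robustWasserstein lam μ ν := by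
  refine Real.sInf_nonneg ?_
  rintro _ ⟨π, -, rfl⟩
  exact integral_nonneg fun z => trimmedCost_nonneg hlam _ _

theorem robustWasserstein_le_of_mem_couplings (hlam : 0 ≤ lam) {μ ν : ProbabilityMeasure X}
    {π : ProbabilityMeasure (X × X)} (hπ : π ∈ couplings μ ν) :
    robustWasserstein lam μ ν ≤ ∫ z, trimmedCost lam z.1 z.2 ∂(π : Measure (X × X)) := by
  refine csInf_le ⟨0, ?_⟩ ⟨π, hπ, rfl⟩
  rintro _ ⟨π, -, rfl⟩
  exact integral_nonneg fun z => trimmedCost_nonneg hlam _ _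

omit [MetricSpace X] in
theorem couplings_nonempty (μ ν : ProbabilityMeasure X) : (couplings μ ν).Nonempty :=
  ⟨μ.prod ν, by simp [couplings]⟩

theorem exists_coupling_lt {μ ν : ProbabilityMeasure X} {r : ℝ}
    (h : robustWasserstein lam μ ν < r) :
    ∃ π ∈ couplings μ ν, ∫ z, trimmedCost lam z.1 z.2 ∂(π : Measure (X × X)) < r := by
  obtain ⟨_, ⟨π, hπ, rfl⟩, hlt⟩ := exists_lt_of_csInf_lt ((couplings_nonempty μ ν).image _) h
  exact ⟨π, hπ, hlt⟩

variable [BorelSpace X] [SeparableSpace X]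

theorem integral_trimmedCost_map {Ω : Type*} [MeasurableSpace Ω] {P : Measure Ω} {f g : Ω → X}
    (hf : Measurable f) (hg : Measurable g) :
    ∫ z, trimmedCost lam z.1 z.2 ∂(P.map fun ω => (f ω, g ω)) =
      ∫ ω, trimmedCost lam (f ω) (g ω) ∂P :=
  integral_map (hf.prodMk hg).aemeasurable
    (measurable_trimmedCost measurable_fst measurable_snd).aestronglyMeasurable

theorem robustWasserstein_le_integral (hlam : 0 ≤ lam) {Ω : Type*} [MeasurableSpace Ω]
    (P : Measure Ω) [IsProbabilityMeasure P] {f g : Ω → X} (hf : Measurable f)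
    (hg : Measurable g) {μ ν : ProbabilityMeasure X} (hμ : P.map f = μ) (hν : P.map g = ν) :
    robustWasserstein lam μ ν ≤ ∫ ω, trimmedCost lam (f ω) (g ω) ∂P := by
  have hfg : Measurable fun ω => (f ω, g ω) := hf.prodMk hg
  rw [← integral_trimmedCost_map hf hg]
  refine robustWasserstein_le_of_mem_couplings hlam
    (π := ⟨P.map fun ω => (f ω, g ω), Measure.isProbabilityMeasure_map hfg.aemeasurable⟩) ⟨?_, ?_⟩
  · exact (Measure.map_map measurable_fst hfg).trans hμ
  · exact (Measure.map_map measurable_snd hfg).trans hν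

theorem robustWasserstein_self (hlam : 0 ≤ lam) (μ : ProbabilityMeasure X) :
    robustWasserstein lam μ μ = 0 := by
  refine le_antisymm ?_ (robustWasserstein_nonneg hlam μ μ)
  refine (robustWasserstein_le_integral hlam (μ : Measure X) measurable_id measurable_id
    Measure.map_id Measure.map_id).trans_eq ?_
  simp [trimmedCost_self hlam]

theorem robustWasserstein_comm (hlam : 0 ≤ lam) (μ ν : ProbabilityMeasure X) :
    robustWasserstein lam μ ν = robustWasserstein lam ν μ := by
  have key (μ ν : ProbabilityMeasure X) :
      robustWasserstein lam μ ν ≤ robustWasserstein lam ν μ := by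
    refine le_of_forall_gt_imp_ge_of_dense fun r hr => ?_
    obtain ⟨π, hπ, hlt⟩ := exists_coupling_lt hr
    refine (robustWasserstein_le_integral hlam (π : Measure (X × X)) measurable_snd
      measurable_fst hπ.2 hπ.1).trans (le_of_eq_of_le ?_ hlt.le)
    simp_rw [trimmedCost_comm]
  exact le_antisymm (key μ ν) (key ν μ)

/-- Two probability measures at robust Wasserstein distance zero are at Lévy–Prokhorov distance
zero, hence equal. -/
theorem eq_of_robustWasserstein_eq_zero (hlam : 0 < lam) {μ ν : ProbabilityMeasure X}
    (h : robustWasserstein lam μ ν = 0) : μ = ν := by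
  have hLP : levyProkhorovEDist (μ : Measure X) ν = 0 := by
    refine le_antisymm (levyProkhorovEDist_le_of_forall_le _ _ 0 fun ε B hε hε' hB => ?_)
      zero_le
    -- Since `r` is at most `2 * lam`, a cost below `r` is a true distance below `ε`. The budget `r
    -- * r` then makes Markov's inequality leave mass at most `r` on the remaining pairs.
    set r := min ε.toReal (2 * lam) with hr
    have hr0 : 0 < r := lt_min (ENNReal.toReal_pos hε.ne' hε'.ne) (by linarith)
    obtain ⟨π, ⟨hπ1, hπ2⟩, hlt⟩ := exists_coupling_lt (r := r * r) (h.trans_lt (by positivity))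
    have hmarkov := mul_meas_ge_le_integral_of_nonneg (μ := (π : Measure (X × X)))
      (ae_of_all _ fun z => trimmedCost_nonneg hlam.le z.1 z.2)
      (integrable_trimmedCost hlam.le measurable_fst measurable_snd) r
    have hsmall : (π : Measure (X × X)).real {z | r ≤ trimmedCost lam z.1 z.2} ≤ r :=
      le_of_mul_le_mul_left (hmarkov.trans hlt.le) hr0
    have hsub : Prod.fst ⁻¹' B ⊆
        Prod.snd ⁻¹' (Metric.thickening ε.toReal B) ∪ {z | r ≤ trimmedCost lam z.1 z.2} := by
      rintro ⟨x, y⟩ hx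
      by_cases hc : r ≤ trimmedCost lam x y
      · exact Or.inr hc
      · left
        rw [not_le] at hc
        refine Metric.mem_thickening_iff.2 ⟨x, hx, ?_⟩
        rw [dist_comm, dist_eq_trimmedCost (hc.trans_le (min_le_right _ _))]
        exact hc.trans_le (min_le_left _ _)
    rw [← hπ1, ← hπ2, Measure.map_apply measurable_fst hB,
      Measure.map_apply measurable_snd Metric.isOpen_thickening.measurableSet]
    refine (measure_mono hsub).trans ((measure_union_le _ _).trans ?_)
    gcongr
    rw [← ofReal_measureReal, ← ENNReal.ofReal_toReal hε'.ne]
    exact ENNReal.ofReal_le_ofReal (hsmall.trans (min_le_left _ _))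
  have hμν : (μ : Measure X) = ν := by
    refine ext_of_generate_finite {s : Set X | IsClosed s}
      (BorelSpace.measurable_eq.trans borel_eq_generateFrom_isClosed) isPiSystem_isClosed
      (fun s hs => ?_) (by simp)
    exact measure_eq_measure_of_levyProkhorovEDist_eq_zero_of_isClosed hLP hs
      ⟨1, one_pos, measure_ne_top _ _⟩ ⟨1, one_pos, measure_ne_top _ _⟩
  exact Subtype.ext hμν

/-- A pairing of the atoms of two finitely supported measures bounds their distance. -/
theorem robustWasserstein_le_sum (hlam : 0 ≤ lam) {ι : Type*} (s : Finset ι) (w : ι → ℝ≥0)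
    (x y : ι → X) {μ ν : ProbabilityMeasure X}
    (hμ : (μ : Measure X) = ∑ i ∈ s, w i • Measure.dirac (x i))
    (hν : (ν : Measure X) = ∑ i ∈ s, w i • Measure.dirac (y i)) :
    robustWasserstein lam μ ν ≤ ∑ i ∈ s, w i * trimmedCost lam (x i) (y i) := by
  set π : Measure (X × X) := ∑ i ∈ s, w i • Measure.dirac (x i, y i) with hπ
  have h1 : π.map Prod.fst = μ := by
    rw [hμ, hπ, ← Measure.mapₗ_apply_of_measurable measurable_fst, map_sum]
    refine Finset.sum_congr rfl fun i _ => ?_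
    rw [Measure.mapₗ_apply_of_measurable measurable_fst, Measure.map_smul,
      Measure.map_dirac' measurable_fst]
  have h2 : π.map Prod.snd = ν := by
    rw [hν, hπ, ← Measure.mapₗ_apply_of_measurable measurable_snd, map_sum]
    refine Finset.sum_congr rfl fun i _ => ?_
    rw [Measure.mapₗ_apply_of_measurable measurable_snd, Measure.map_smul,
      Measure.map_dirac' measurable_snd]
  have hprob : IsProbabilityMeasure π := by
    have : IsProbabilityMeasure (π.map Prod.fst) := h1 ▸ inferInstance
    exact Measure.isProbabilityMeasure_of_map Prod.fst
  refine (robustWasserstein_le_integral hlam π measurable_fst measurable_snd h1 h2).trans_eq ?_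
  have hm := measurable_trimmedCost (lam := lam) (measurable_fst (α := X) (β := X))
    (measurable_snd (α := X) (β := X))
  rw [hπ, integral_finsetSum_measure fun i _ =>
    integrable_trimmedCost hlam measurable_fst measurable_snd]
  refine Finset.sum_congr rfl fun i _ => ?_
  rw [integral_smul_nnreal_measure, integral_dirac' _ _ hm.stronglyMeasurable]
  rfl

variable [CompleteSpace X]

theorem exists_process_of_couplings {u : ℕ → ProbabilityMeasure X}
    {π : ℕ → ProbabilityMeasure (X × X)} (hπ : ∀ n, π n ∈ couplings (u n) (u (n + 1))) :
    ∃ P : Measure (ℕ → X), IsProbabilityMeasure P ∧ (∀ n, P.map (fun ω => ω n) = u n) ∧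
      ∀ n, ∫ ω, trimmedCost lam (ω n) (ω (n + 1)) ∂P =
        ∫ z, trimmedCost lam z.1 z.2 ∂(π n : Measure (X × X)) := by
  have : SecondCountableTopology X := UniformSpace.secondCountable_of_separable X
  have : Nonempty X := nonempty_of_isProbabilityMeasure (u 0 : Measure X)
  obtain ⟨P, hP, h⟩ := exists_measure_map_consecutive_eq (fun n => (π n : Measure (X × X)))
    fun n => (hπ n).2.trans (hπ (n + 1)).1.symm
  refine ⟨P, hP, fun n => ?_, fun n => ?_⟩
  · rw [← (hπ n).1, ← h n, Measure.map_map measurable_fst (by fun_prop)]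
    rfl
  · rw [← h n, integral_trimmedCost_map (by fun_prop) (by fun_prop)]

theorem robustWasserstein_triangle (hlam : 0 ≤ lam) (μ ν ρ : ProbabilityMeasure X) :
    robustWasserstein lam μ ρ ≤ robustWasserstein lam μ ν + robustWasserstein lam ν ρ := by
  refine le_of_forall_pos_le_add fun ε hε => ?_
  obtain ⟨π₁, h₁, hlt₁⟩ := exists_coupling_lt (lt_add_of_pos_right
    (robustWasserstein lam μ ν) (half_pos hε))
  obtain ⟨π₂, h₂, hlt₂⟩ := exists_coupling_lt (lt_add_of_pos_right
    (robustWasserstein lam ν ρ) (half_pos hε))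
  -- Only times 0, 1 and 2 matter; the sequence is padded with `ρ` to fit the process lemma.
  let u : ℕ → ProbabilityMeasure X
    | 0 => μ
    | 1 => ν
    | _ => ρ
  let π : ℕ → ProbabilityMeasure (X × X)
    | 0 => π₁
    | 1 => π₂
    | _ => ρ.prod ρ
  have hπ : ∀ n, π n ∈ couplings (u n) (u (n + 1))
    | 0 => h₁
    | 1 => h₂
    | n + 2 => by simp [couplings, π, u]
  obtain ⟨P, hP, hlaw, hint⟩ := exists_process_of_couplings (lam := lam) hπ
  have hi (i j : ℕ) : Integrable (fun ω : ℕ → X => trimmedCost lam (ω i) (ω j)) P :=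
    integrable_trimmedCost hlam (measurable_pi_apply i) (measurable_pi_apply j)
  calc robustWasserstein lam μ ρ
      ≤ ∫ ω, trimmedCost lam (ω 0) (ω 2) ∂P :=
        robustWasserstein_le_integral hlam P (measurable_pi_apply 0) (measurable_pi_apply 2)
          (hlaw 0) (hlaw 2)
    _ ≤ ∫ ω, (trimmedCost lam (ω 0) (ω 1) + trimmedCost lam (ω 1) (ω 2)) ∂P :=
        integral_mono (hi 0 2) ((hi 0 1).add (hi 1 2)) fun ω => trimmedCost_triangle hlam _ _ _
    _ = ∫ z, trimmedCost lam z.1 z.2 ∂(π₁ : Measure (X × X)) +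
          ∫ z, trimmedCost lam z.1 z.2 ∂(π₂ : Measure (X × X)) := by
        rw [integral_add (hi 0 1) (hi 1 2)]
        exact congrArg₂ (· + ·) (hint 0) (hint 1)
    _ ≤ _ := by linarith

/-- A sequence of measures whose consecutive distances are summable converges: it is the sequence
of laws of an almost surely convergent process. -/
theorem exists_tendsto_robustWasserstein (hlam : 0 < lam) {u : ℕ → ProbabilityMeasure X}
    {b : ℕ → ℝ} (hb : Summable b) (h : ∀ n, robustWasserstein lam (u n) (u (n + 1)) < b n) :
    ∃ μ : ProbabilityMeasure X,
      Tendsto (fun n => robustWasserstein lam (u n) μ) atTop (𝓝 0) := by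
  choose π hπ hlt using fun n => exists_coupling_lt (h n)
  obtain ⟨P, hP, hlaw, hint⟩ := exists_process_of_couplings (lam := lam) hπ
  have hi (n : ℕ) : Integrable (fun ω : ℕ → X => trimmedCost lam (ω n) (ω (n + 1))) P :=
    integrable_trimmedCost hlam.le (measurable_pi_apply _) (measurable_pi_apply _)
  have hb0 (n : ℕ) : 0 ≤ b n := (robustWasserstein_nonneg hlam.le _ _).trans (h n).le
  have hsum : ∑' n, ∫⁻ ω : ℕ → X, ENNReal.ofReal (trimmedCost lam (ω n) (ω (n + 1))) ∂P ≠ ∞ := by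
    refine ne_top_of_le_ne_top hb.tsum_ofReal_ne_top (ENNReal.tsum_le_tsum fun n => ?_)
    rw [← ofReal_integral_eq_lintegral_ofReal (hi n)
      (ae_of_all _ fun ω => trimmedCost_nonneg hlam.le _ _), hint n]
    exact ENNReal.ofReal_le_ofReal (hlt n).le
  have hm (n : ℕ) :
      Measurable fun ω : ℕ → X => ENNReal.ofReal (trimmedCost lam (ω n) (ω (n + 1))) :=
    (measurable_trimmedCost (measurable_pi_apply n)
      (measurable_pi_apply (n + 1))).ennreal_ofReal
  rw [← lintegral_tsum fun n => (hm n).aemeasurable] at hsum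
  have hconv : ∀ᵐ ω ∂P, ∃ l : X, Tendsto (fun n => ω n) atTop (𝓝 l) := by
    filter_upwards [ae_lt_top (Measurable.tsum hm) hsum] with ω hω
    have hs : Summable fun n => trimmedCost lam (ω n) (ω (n + 1)) := by
      refine (ENNReal.summable_toReal hω.ne).congr fun n => ?_
      exact ENNReal.toReal_ofReal (trimmedCost_nonneg hlam.le _ _)
    -- Summable terms reach the cap only finitely often.
    have hev : ∀ᶠ n in atTop, trimmedCost lam (ω n) (ω (n + 1)) < 2 * lam :=
      hs.tendsto_atTop_zero.eventually_lt_const (by linarith)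
    have hd : Summable fun n => dist (ω n) (ω (n + 1)) := by
      refine (summable_congr_atTop ?_).2 hs
      filter_upwards [hev] with n hn using dist_eq_trimmedCost hn
    exact cauchySeq_tendsto_of_complete (cauchySeq_of_summable_dist hd)
  obtain ⟨g, hg, hlim⟩ := measurable_limit_of_tendsto_metrizable_ae
    (fun n => (measurable_pi_apply (X := fun _ : ℕ => X) n).aemeasurable) hconv
  refine ⟨⟨P.map g, Measure.isProbabilityMeasure_map hg.aemeasurable⟩, ?_⟩
  refine squeeze_zero (fun n => robustWasserstein_nonneg hlam.le _ _)
    (fun n => robustWasserstein_le_integral hlam.le P (measurable_pi_apply n) hg (hlaw n) rfl)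
    (tendsto_integral_trimmedCost_zero hlam.le (fun n => measurable_pi_apply n) hg hlim)

end Distance

/-! ### Density of rational combinations -/

section Approximation

/-- A nonnegative real is approximated from below by nonnegative rationals. -/
theorem exists_nnrat_le_lt_add (p : ℝ≥0) {δ : ℝ≥0} (hδ : 0 < δ) :
    ∃ q : ℚ≥0, (q : ℝ≥0) ≤ p ∧ p - q ≤ δ := by
  rcases lt_or_ge p δ with h | h
  · exact ⟨0, by simp, by simpa using h.le⟩
  · have hlt : (p : ℝ) - δ < p := sub_lt_self _ hδ
    obtain ⟨q, hq1, hq2⟩ := exists_rat_btwn hlt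
    have hq0 : 0 ≤ q := by
      have : (0 : ℝ) ≤ q := (sub_nonneg.2 (NNReal.coe_le_coe.2 h)).trans hq1.le
      exact_mod_cast this
    lift q to ℚ≥0 using hq0
    refine ⟨q, ?_, tsub_le_iff_left.2 ?_⟩
    · rw [← NNReal.coe_le_coe]
      exact_mod_cast hq2.le
    · rw [← NNReal.coe_le_coe]
      have hq1' : (p : ℝ) - δ < ((q : ℝ≥0) : ℝ) := by exact_mod_cast hq1
      rw [NNReal.coe_add]
      linarith

/-- The finite measure with mass `w k` at the point `e k`. -/
noncomputable def ratCombination {X : Type*} [MeasurableSpace X] (e : ℕ → X) (w : ℕ →₀ ℚ≥0) : Measure X :=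
  w.sum fun k q => ((q : ℝ≥0) : ℝ≥0∞) • Measure.dirac (e k)

variable {X : Type*} [MeasurableSpace X]

theorem ratCombination_add (e : ℕ → X) (v w : ℕ →₀ ℚ≥0) :
    ratCombination e (v + w) = ratCombination e v + ratCombination e w :=
  Finsupp.sum_add_index' (by simp) (by simp [add_smul])

theorem ratCombination_single (e : ℕ → X) (k : ℕ) (q : ℚ≥0) :
    ratCombination e (Finsupp.single k q) = (q : ℝ≥0) • Measure.dirac (e k) :=
  Finsupp.sum_single_index (by simp)

theorem ratCombination_sum_single (e : ℕ → X) (s : Finset ℕ) (q : ℕ → ℚ≥0) :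
    ratCombination e (∑ k ∈ s, Finsupp.single k (q k)) =
      ∑ k ∈ s, (q k : ℝ≥0) • Measure.dirac (e k) := by
  induction s using Finset.cons_induction with
  | empty => simp [ratCombination]
  | cons a s ha ih => rw [sum_cons, sum_cons, ratCombination_add, ih, ratCombination_single]

/-- The probability measures with rational masses at the points of the sequence `e`. -/
def ratMeasures (e : ℕ → X) : Set (ProbabilityMeasure X) :=
  {μ | ∃ w : ℕ →₀ ℚ≥0, (μ : Measure X) = ratCombination e w}

/-- There are only countably many finitely supported rational weights on `ℕ`. -/
theorem countable_ratMeasures (e : ℕ → X) : (ratMeasures e).Countable := by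
  have hinj : Function.Injective fun μ : ProbabilityMeasure X => (μ : Measure X) :=
    Subtype.val_injective
  refine ((Set.countable_range (ratCombination e)).preimage hinj).mono ?_
  rintro μ ⟨w, hw⟩
  exact ⟨w, hw.symm⟩

theorem ratMeasures_subset (e : ℕ → X) : ratMeasures e ⊆ finiteRationalMeasures X := by
  rintro μ ⟨w, hw⟩
  -- `e` may repeat points; `mapDomain` adds up the weights that land on the same point.
  refine ⟨(w.mapDomain e).support, w.mapDomain e, hw.trans ?_⟩
  exact (Finsupp.sum_mapDomain_index
    (h := fun (x : X) (q : ℚ≥0) => ((q : ℝ≥0) : ℝ≥0∞) • Measure.dirac x)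
    (by simp) (by simp [add_smul])).symm

variable [MetricSpace X] [BorelSpace X] [SeparableSpace X] {lam : ℝ}

/-- Rounding down the weights of a finitely supported probability measure, and putting the missing
mass at one of the atoms, moves the measure as little as desired. -/
theorem exists_ratMeasure_near_sum (hlam : 0 < lam) (e : ℕ → X) (s : Finset ℕ) (p : ℕ → ℝ≥0)
    {μ : ProbabilityMeasure X} (hμ : (μ : Measure X) = ∑ k ∈ s, p k • Measure.dirac (e k))
    {ε : ℝ} (hε : 0 < ε) : ∃ ν ∈ ratMeasures e, robustWasserstein lam μ ν < ε := by
  have hp : ∑ k ∈ s, p k = 1 := by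
    have h1 : (μ : Measure X) Set.univ = 1 := measure_univ
    rw [hμ] at h1
    simp only [Measure.coe_finsetSum, Finset.sum_apply, Measure.smul_apply, measure_univ,
      ENNReal.smul_def, smul_eq_mul, mul_one] at h1
    exact_mod_cast h1
  -- The excess `#s + 1` over `#s` makes the final bound strict and the denominator visibly
  -- positive.
  obtain ⟨δ, hδ, hδε⟩ : ∃ δ : ℝ, 0 < δ ∧ (#s + 1) * (δ * (2 * lam)) = ε :=
    ⟨ε / ((#s + 1) * (2 * lam)), by positivity, by field_simp⟩
  choose q hq hpq using fun k => exists_nnrat_le_lt_add (p k) (δ := ⟨δ, hδ.le⟩) hδ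
  have hqsum : ∑ k ∈ s, q k ≤ 1 := by
    have : ((∑ k ∈ s, q k : ℚ≥0) : ℝ≥0) ≤ 1 := by
      push_cast
      exact hp ▸ Finset.sum_le_sum fun k _ => hq k
    exact_mod_cast this
  obtain ⟨r, hr⟩ := exists_add_of_le hqsum
  have hr' : (r : ℝ≥0) = ∑ k ∈ s, (p k - q k) := by
    have h1 : ∑ k ∈ s, (q k : ℝ≥0) + r = 1 := by
      have := congrArg (fun t : ℚ≥0 => (t : ℝ≥0)) hr
      push_cast at this
      exact this.symm
    have h2 : ∑ k ∈ s, (q k : ℝ≥0) + ∑ k ∈ s, (p k - q k) = 1 := by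
      rw [← sum_add_distrib, ← hp]
      exact Finset.sum_congr rfl fun k _ => add_tsub_cancel_of_le (hq k)
    exact add_left_cancel (h1.trans h2.symm)
  set w : ℕ →₀ ℚ≥0 := ∑ k ∈ s, Finsupp.single k (q k) + Finsupp.single 0 r
  have hw : ratCombination e w =
      ∑ k ∈ s, (q k : ℝ≥0) • Measure.dirac (e k) + (r : ℝ≥0) • Measure.dirac (e 0) := by
    rw [ratCombination_add, ratCombination_sum_single, ratCombination_single]
  have hprob : IsProbabilityMeasure (ratCombination e w) := by
    refine ⟨?_⟩
    have h1 := congrArg (fun t : ℚ≥0 => (t : ℝ≥0)) hr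
    push_cast at h1
    rw [hw]
    simp only [Measure.coe_add, Measure.coe_finsetSum, Pi.add_apply, Finset.sum_apply,
      Measure.smul_apply, measure_univ, ENNReal.smul_def, smul_eq_mul, mul_one]
    exact_mod_cast h1.symm
  refine ⟨⟨ratCombination e w, hprob⟩, ⟨w, rfl⟩, ?_⟩
  -- Each atom is split in two: the rounded weight stays put at no cost, the remainder moves to `e
  -- 0`.
  have hle := robustWasserstein_le_sum hlam.le (s.disjSum s)
    (Sum.elim (fun k => (q k : ℝ≥0)) fun k => p k - q k) (Sum.elim e e)
    (Sum.elim e fun _ => e 0) (μ := μ) (ν := ⟨ratCombination e w, hprob⟩)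
    (by
      rw [hμ, Finset.sum_disjSum, ← sum_add_distrib]
      refine Finset.sum_congr rfl fun k _ => ?_
      simp only [Sum.elim_inl, Sum.elim_inr, ← add_smul]
      rw [add_tsub_cancel_of_le (hq k)])
    (by
      rw [Finset.sum_disjSum]
      simp only [Sum.elim_inl, Sum.elim_inr]
      rw [← Finset.sum_smul, ← hr']
      exact hw)
  refine hle.trans_lt ?_
  rw [Finset.sum_disjSum]
  simp only [Sum.elim_inl, Sum.elim_inr, trimmedCost_self hlam.le, mul_zero, sum_const_zero,
    zero_add]
  calc ∑ k ∈ s, ((p k - q k : ℝ≥0) : ℝ) * trimmedCost lam (e k) (e 0)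
      ≤ ∑ _k ∈ s, δ * (2 * lam) := by
        refine Finset.sum_le_sum fun k _ => ?_
        exact mul_le_mul (hpq k) (trimmedCost_le _ _) (trimmedCost_nonneg hlam.le _ _) hδ.le
    _ = #s * (δ * (2 * lam)) := by rw [sum_const, nsmul_eq_mul]
    _ < ε := by
        have : 0 < δ * (2 * lam) := by positivity
        linarith

variable [CompleteSpace X]

theorem exists_ratMeasure_near (hlam : 0 < lam) {e : ℕ → X} (he : DenseRange e)
    (μ : ProbabilityMeasure X) {ε : ℝ} (hε : 0 < ε) :
    ∃ ν ∈ ratMeasures e, robustWasserstein lam μ ν < ε := by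
  have htend := tendsto_integral_trimmedCost_zero (P := (μ : Measure X)) (lam := lam) hlam.le
    (fun N => (SimpleFunc.nearestPt e N).measurable) measurable_id
    (ae_of_all _ fun x => SimpleFunc.tendsto_nearestPt (he x))
  obtain ⟨N, hN⟩ := (htend.eventually_lt_const (half_pos hε)).exists
  set I := SimpleFunc.nearestPtInd e N
  set f := SimpleFunc.nearestPt e N
  let μ' : ProbabilityMeasure X :=
    ⟨(μ : Measure X).map f, Measure.isProbabilityMeasure_map f.measurable.aemeasurable⟩
  have h1 : robustWasserstein lam μ μ' < ε / 2 := by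
    refine lt_of_le_of_lt ?_ hN
    rw [robustWasserstein_comm hlam.le]
    exact robustWasserstein_le_integral hlam.le (μ : Measure X) f.measurable measurable_id
      rfl Measure.map_id
  -- Atoms are grouped by index, not by position, so `e` need not be injective.
  have hμ' : (μ' : Measure X) =
      ∑ k ∈ I.range, μ (I ⁻¹' {k}) • Measure.dirac (e k) := by
    ext B hB
    change (μ : Measure X).map f B = _
    rw [Measure.map_apply f.measurable hB]
    simp only [Measure.coe_finsetSum, Finset.sum_apply, Measure.smul_apply,
      Measure.dirac_apply' _ hB, ENNReal.smul_def, smul_eq_mul,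
      ProbabilityMeasure.ennreal_coeFn_eq_coeFn_toMeasure]
    classical
    rw [show f ⁻¹' B = _ from SimpleFunc.map_preimage I e B, ← SimpleFunc.sum_measure_preimage_singleton,
      Finset.sum_filter]
    refine Finset.sum_congr (by congr) fun k _ => ?_
    by_cases hk : e k ∈ B <;> simp [hk]
  obtain ⟨ν, hν, h2⟩ := exists_ratMeasure_near_sum hlam e _ _ hμ' (half_pos hε)
  refine ⟨ν, hν, ?_⟩
  linarith [robustWasserstein_triangle hlam.le μ μ' ν]

end Approximation

/-! ### The metric space of probability measures -/

/-- The metric on probability measures given by the robust Wasserstein distance. -/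
@[reducible]
noncomputable def robustWassersteinMetricSpace (X : Type*) [MetricSpace X] [CompleteSpace X] [SeparableSpace X]
    [MeasurableSpace X] [BorelSpace X] {lam : ℝ} (hlam : 0 < lam) : MetricSpace (ProbSpace X) where
  dist := robustWasserstein lam
  dist_self := robustWasserstein_self hlam.le
  dist_comm := robustWasserstein_comm hlam.le
  dist_triangle := robustWasserstein_triangle hlam.le
  eq_of_dist_eq_zero := eq_of_robustWasserstein_eq_zero hlam

theorem theorem5 {X : Type*} [MetricSpace X] [CompleteSpace X] [SeparableSpace X]
    [MeasurableSpace X] [BorelSpace X] (lam : ℝ) (hlam : 0 < lam) :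
    ∃ _ : MetricSpace (ProbSpace X),
      (∀ μ ν : ProbSpace X, dist μ ν = robustWasserstein lam μ ν) ∧
      CompleteSpace (ProbSpace X) ∧
      SeparableSpace (ProbSpace X) ∧
      Dense (finiteRationalMeasures X) := by
  let inst := robustWassersteinMetricSpace X hlam
  refine ⟨inst, fun _ _ => rfl, ?_, ?_⟩
  · refine Metric.complete_of_convergent_controlled_sequences (fun n => (1 / 2) ^ n) (by simp)
      fun u hu => ?_
    obtain ⟨μ, hμ⟩ := exists_tendsto_robustWasserstein hlam (u := u) summable_geometric_two
      fun n => hu n n (n + 1) le_rfl (Nat.le_succ n)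
    exact ⟨μ, tendsto_iff_dist_tendsto_zero.2 hμ⟩
  -- `denseSeq` needs a point; over an empty space there are no probability measures.
  rcases isEmpty_or_nonempty X with hX | hX
  · have : IsEmpty (ProbSpace X) :=
      ⟨fun μ : ProbabilityMeasure X =>
        hX.false (nonempty_of_isProbabilityMeasure (μ : Measure X)).some⟩
    exact ⟨inferInstance, fun μ => this.elim μ⟩
  have hdense : Dense (X := ProbSpace X) (ratMeasures (denseSeq X)) := fun μ =>
    Metric.mem_closure_iff.2 fun ε hε => exists_ratMeasure_near hlam (denseRange_denseSeq X) μ hε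
  exact ⟨⟨_, countable_ratMeasures _, hdense⟩, hdense.mono (ratMeasures_subset _)⟩
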